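/- Let $v\ge 2$ and let $\mathcal A_v$ be the real Cayley-Dickson algebra of dimension $2^v$ (so $\mathcal A_2$ is the quaternions and $\mathcal A_3$ the octonions), with conjugation $z\mapsto z^*$ and Euclidean norm $|z|=(zz^*)^{1/2}$, and let $\mathcal I_v=\{M\in\mathcal A_v : M+M^*=0\}$ be the space of purely imaginary elements. Let $\Gamma$ be the Gamma function of $\mathcal A_v$: $\Gamma(z)=\int_0^\infty e^{-t}t^{z-1}\,dt$, where $t^{z}=\exp(z\ln t)$, whenever this integral converges, and $\Gamma$ is extended to $\mathcal A_v\setminus\{0,-1,-2,\dots\}$ by $\mathcal A_v$-holomorphic continuation. (A function is $\mathcal A_v$-holomorphic if near each point $c$ of its domain it is the sum of a convergent power series in the variable $z-c$, whose terms of degree $k$ are finite sums of products, bracketed in any way, of $k$ factors $z-c$ and of constants from $\mathcal A_v$.) Then for every $x\in\mathbb R$ $$|\Gamma(x+My)|\sim (2\pi)^{1/2}\,|y|^{x-1/2}\exp(-\pi|y|/2)\qquad (y\in\mathbb R,\ |y|\to\infty),$$ that is, the quotient of the two sides tends to $1$, uniformly in $M\in\mathcal I_v$ with $|M|=1$: for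 every $\varepsilon>0$ there is $R>0$ such that for all $M\in\mathcal I_v$ with $|M|=1$ and all real $y$ with $|y|\ge R$ the quotient differs from $1$ by less than $\varepsilon$. -/

import Mathlib

/-- The real vector space underlying the Cayley-Dickson algebra `A_v`, obtained from `ℝ` by `v`
doublings. The factor `WithLp 2` makes the norm of `A_v` the Euclidean norm
`‖a + b l‖ ^ 2 = ‖a‖ ^ 2 + ‖b‖ ^ 2`. -/
def CayleyDickson : ℕ → Type
  | 0 => ℝ
  | v + 1 => WithLp 2 (CayleyDickson v × CayleyDickson v)

namespace CayleyDickson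

noncomputable instance instNormedAddCommGroup : (v : ℕ) → NormedAddCommGroup (CayleyDickson v)
  | 0 => inferInstanceAs (NormedAddCommGroup ℝ)
  | v + 1 =>
    letI := instNormedAddCommGroup v
    inferInstanceAs (NormedAddCommGroup (WithLp 2 (CayleyDickson v × CayleyDickson v)))

noncomputable instance instNormedSpace : (v : ℕ) → NormedSpace ℝ (CayleyDickson v)
  | 0 => inferInstanceAs (NormedSpace ℝ ℝ)
  | v + 1 =>
    letI := instNormedSpace v
    inferInstanceAs (NormedSpace ℝ (WithLp 2 (CayleyDickson v × CayleyDickson v)))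

instance instFiniteDimensional : (v : ℕ) → FiniteDimensional ℝ (CayleyDickson v)
  | 0 => inferInstanceAs (FiniteDimensional ℝ ℝ)
  | v + 1 =>
    letI := instFiniteDimensional v
    inferInstanceAs (FiniteDimensional ℝ (WithLp 2 (CayleyDickson v × CayleyDickson v)))

instance instCompleteSpace (v : ℕ) : CompleteSpace (CayleyDickson v) :=
  FiniteDimensional.complete ℝ (CayleyDickson v)

/-- The element `a + b l` of the doubled algebra. -/
def pair {v : ℕ} (a b : CayleyDickson v) : CayleyDickson (v + 1) :=
  WithLp.toLp 2 (a, b)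

/-- The component `a` of `a + b l`. -/
def left {v : ℕ} (z : CayleyDickson (v + 1)) : CayleyDickson v :=
  (WithLp.ofLp z : CayleyDickson v × CayleyDickson v).1

/-- The component `b` of `a + b l`. -/
def right {v : ℕ} (z : CayleyDickson (v + 1)) : CayleyDickson v :=
  (WithLp.ofLp z : CayleyDickson v × CayleyDickson v).2

/-- The unit of `A_v`. -/
noncomputable def one : (v : ℕ) → CayleyDickson v
  | 0 => (1 : ℝ)
  | v + 1 => pair (one v) 0

/-- Conjugation: `(a + b l)* = a* - b l`. -/
noncomputable def conj : {v : ℕ} → CayleyDickson v → CayleyDickson v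
  | 0, z => z
  | _ + 1, z => pair (conj (left z)) (-right z)

/-- Multiplication: `(a + b l) (c + d l) = (a c - d* b) + (d a + b c*) l`. -/
noncomputable def mul : {v : ℕ} → CayleyDickson v → CayleyDickson v → CayleyDickson v
  | 0, z, w => (fun x y : ℝ => x * y) z w
  | _ + 1, z, w =>
    pair (mul (left z) (left w) - mul (conj (right w)) (right z))
      (mul (right w) (left z) + mul (right z) (conj (left w)))

noncomputable instance (v : ℕ) : One (CayleyDickson v) := ⟨one v⟩

noncomputable instance (v : ℕ) : Mul (CayleyDickson v) := ⟨mul⟩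

/-- The real part `(z + z*) / 2`, as an element of `A_v`. -/
noncomputable def re {v : ℕ} (z : CayleyDickson v) : CayleyDickson v :=
  (1 / 2 : ℝ) • (z + conj z)

/-- The space `I_v` of purely imaginary Cayley-Dickson numbers. -/
def imaginary (v : ℕ) : Set (CayleyDickson v) := {M | re M = 0}

/-- Powers with natural exponents (`A_v` is power-associative, so the bracketing is irrelevant). -/
noncomputable def npow {v : ℕ} (z : CayleyDickson v) : ℕ → CayleyDickson v
  | 0 => 1
  | n + 1 => npow z n * z

/-- The exponential `∑ zⁿ / n!`. -/
noncomputable def exp {v : ℕ} (z : CayleyDickson v) : CayleyDickson v :=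
  ∑' n : ℕ, ((n.factorial : ℝ)⁻¹) • npow z n

/-- The power `t ^ z = exp (z ln t)` of a real number `t > 0` (principal value). -/
noncomputable def rpow {v : ℕ} (t : ℝ) (z : CayleyDickson v) : CayleyDickson v :=
  exp (Real.log t • z)

/-- `IsHomogeneous k P`: the map `P : A_v → A_v` is a homogeneous polynomial of degree `k` in one
Cayley-Dickson variable, that is, a finite sum of products, bracketed in any way, of `k` copies of
the variable and of constants of `A_v`, which may stand in any position. -/
inductive IsHomogeneous {v : ℕ} : ℕ → (CayleyDickson v → CayleyDickson v) → Prop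
  | const (a : CayleyDickson v) : IsHomogeneous 0 (fun _ => a)
  | var : IsHomogeneous 1 (fun h => h)
  | mul {m n : ℕ} {P Q : CayleyDickson v → CayleyDickson v} :
      IsHomogeneous m P → IsHomogeneous n Q → IsHomogeneous (m + n) (fun h => P h * Q h)
  | add {m : ℕ} {P Q : CayleyDickson v → CayleyDickson v} :
      IsHomogeneous m P → IsHomogeneous m Q → IsHomogeneous m (fun h => P h + Q h)

/-- `f` is `A_v`-holomorphic at `c`: in a ball around `c` it is the sum of a convergent power series
in the Cayley-Dickson variable `z - c` with coefficients in `A_v`. -/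
def HolomorphicAt {v : ℕ} (f : CayleyDickson v → CayleyDickson v) (c : CayleyDickson v) : Prop :=
  ∃ r : ℝ, 0 < r ∧ ∃ P : ℕ → CayleyDickson v → CayleyDickson v,
    (∀ k, IsHomogeneous k (P k)) ∧
      ∀ h : CayleyDickson v, ‖h‖ < r → HasSum (fun k => P k h) (f (c + h))

/-- The integrand `e^{-t} t^{z-1}` of Euler's integral of the second kind. -/
noncomputable def gammaIntegrand {v : ℕ} (z : CayleyDickson v) (t : ℝ) : CayleyDickson v :=
  Real.exp (-t) • rpow t (z - 1)

/-- The points `0, -1, -2, …`. -/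
def gammaPoles (v : ℕ) : Set (CayleyDickson v) :=
  {z | ∃ n : ℕ, z = -((n : ℝ) • (1 : CayleyDickson v))}

/-- `G` is given by Euler's integral wherever this integral converges, and it is `A_v`-holomorphic
outside `0, -1, -2, …`, so that it continues the integral holomorphically. At the points
`0, -1, -2, …` themselves it has, by convention, the value `0`. -/
structure IsGamma {v : ℕ} (G : CayleyDickson v → CayleyDickson v) : Prop where
  eq_integral : ∀ z, MeasureTheory.IntegrableOn (gammaIntegrand z) (Set.Ioi 0) →
    G z = ∫ t in Set.Ioi (0 : ℝ), gammaIntegrand z t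
  holomorphic : ∀ z, z ∉ gammaPoles v → HolomorphicAt G z
  eq_zero : ∀ z ∈ gammaPoles v, G z = 0

open Classical in
/-- The Gamma function of `A_v`: the `A_v`-holomorphic continuation of Euler's integral.
For `v ≥ 1` there is exactly one function as in `IsGamma`. The second branch only makes the
definition total. -/
noncomputable def Gamma {v : ℕ} : CayleyDickson v → CayleyDickson v :=
  if h : ∃ G : CayleyDickson v → CayleyDickson v, IsGamma G then Classical.choose h else 0

end CayleyDickson

open Filter Topology

/-! For an imaginary unit `M`, the map `a + bi ↦ a + bM` is an isometric algebra embedding of ℂ in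
`A_v`, and these slices cover `A_v`. On each slice Γ is the image of the complex Gamma function
(`IsGamma.eq_ofComplex`). Hence `‖Γ(x + yM)‖ = |Γ(x + iy)|` exactly, and uniformity in `M` is
automatic.

The complex asymptotics need no Stirling series. The reflection formula gives `|Γ(iy)|` in closed
form, and the functional equation shifts `x` by integers. For `0 ≤ x ≤ 1`, Euler's product shows
that `log |Γ(x + iy)|` differs from its linear interpolation between `x = 0` and `x = 1` by at most
`∑ 1/(j² + y²) → 0` (`abs_log_norm_Gamma_sub_lerp_le`), while the logarithm of the model is affine
in `x`.

Since `Gamma` is a chosen function, existence has to be shown: `sliceGamma` satisfies `IsGamma`. At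
real points real Taylor coefficients give its power series; elsewhere it is real analytic, which for
`v ≥ 2` implies holomorphy because the real part is itself a Cayley-Dickson polynomial
(`HolomorphicAt.of_analyticAt`). The identity theorem on horizontal lines then determines the chosen
function off the real axis. -/

/-! ### Near-linearity of `log |t + iy|` on unit intervals -/

theorem abs_sub_lerp_le {f f' : ℝ → ℝ} {a K x : ℝ} (hf : ∀ t, HasDerivAt f (f' t) t)
    (hK : ∀ s ∈ Set.Icc a (a + 1), ∀ t ∈ Set.Icc a (a + 1), |f' s - f' t| ≤ K)
    (hx0 : 0 ≤ x) (hx1 : x ≤ 1) :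
    |f (a + x) - ((1 - x) * f a + x * f (a + 1))| ≤ K := by
  have hK0 : 0 ≤ K := (abs_nonneg _).trans
    (hK a ⟨le_rfl, by linarith⟩ a ⟨le_rfl, by linarith⟩)
  rcases hx0.eq_or_lt with rfl | hx0
  · simpa using hK0
  rcases hx1.eq_or_lt with rfl | hx1
  · simpa using hK0
  have hc : Continuous f := continuous_iff_continuousAt.2 fun t => (hf t).continuousAt
  obtain ⟨s, hs, hs'⟩ := exists_hasDerivAt_eq_slope f f' (show a < a + x by linarith)
    hc.continuousOn fun t _ => hf t
  obtain ⟨t, ht, ht'⟩ := exists_hasDerivAt_eq_slope f f' (show a + x < a + 1 by linarith)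
    hc.continuousOn fun t _ => hf t
  have h1 : f (a + x) - f a = x * f' s := by
    rw [hs', add_sub_cancel_left]; field_simp
  have h2 : f (a + 1) - f (a + x) = (1 - x) * f' t := by
    rw [ht']
    have : (a + 1 - (a + x)) = 1 - x := by ring
    rw [this]
    have : 1 - x ≠ 0 := by linarith
    field_simp
  -- The mean values on the two sides of `a + x`, weighted by `1 - x` and `x`, leave only a
  -- difference of derivatives.
  have h3 : f (a + x) - ((1 - x) * f a + x * f (a + 1)) = (x * (1 - x)) * (f' s - f' t) := by
    linear_combination (1 - x) * h1 - x * h2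
  rw [h3, abs_mul, abs_of_nonneg (by nlinarith)]
  have h4 := hK s ⟨hs.1.le, by linarith [hs.2]⟩ t ⟨by linarith [ht.1], ht.2.le⟩
  have h5 : x * (1 - x) ≤ 1 := by nlinarith
  calc x * (1 - x) * |f' s - f' t| ≤ 1 * |f' s - f' t| := by gcongr
    _ ≤ K := by linarith

/-- Bounds the oscillation of the derivative of `log |t + iy|`. For `s ≤ t`, the estimate `|st - y²|
≤ t² + y²` cancels one of the two denominators. -/
theorem abs_div_sq_add_sq_sub_le {a y s t : ℝ} (ha : 0 ≤ a) (hy : 0 < y)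
    (hs : s ∈ Set.Icc a (a + 1)) (ht : t ∈ Set.Icc a (a + 1)) :
    |s / (s ^ 2 + y ^ 2) - t / (t ^ 2 + y ^ 2)| ≤ 1 / (a ^ 2 + y ^ 2) := by
  wlog hst : s ≤ t generalizing s t
  · rw [abs_sub_comm]; exact this ht hs (le_of_not_ge hst)
  have hs0 : 0 ≤ s := ha.trans hs.1
  have ht0 : 0 ≤ t := ha.trans ht.1
  have hS : 0 < s ^ 2 + y ^ 2 := by positivity
  have hT : 0 < t ^ 2 + y ^ 2 := by positivity
  have hA : 0 < a ^ 2 + y ^ 2 := by positivity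
  have key : s / (s ^ 2 + y ^ 2) - t / (t ^ 2 + y ^ 2) =
      ((t - s) * (s * t - y ^ 2) / (t ^ 2 + y ^ 2)) / (s ^ 2 + y ^ 2) := by
    field_simp; ring
  rw [key, abs_div, abs_of_pos hS]
  have h1 : |(t - s) * (s * t - y ^ 2) / (t ^ 2 + y ^ 2)| ≤ 1 := by
    rw [abs_div, abs_of_pos hT, div_le_one hT, abs_mul, abs_of_nonneg (sub_nonneg.2 hst)]
    have h2 : |s * t - y ^ 2| ≤ t ^ 2 + y ^ 2 := by
      rw [abs_le]; constructor <;> nlinarith [mul_nonneg hs0 ht0, sq_nonneg y]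
    have h3 : t - s ≤ 1 := by linarith [hs.1, ht.2]
    calc (t - s) * |s * t - y ^ 2| ≤ 1 * |s * t - y ^ 2| := by gcongr
      _ ≤ _ := by linarith
  have h2 : a ^ 2 + y ^ 2 ≤ s ^ 2 + y ^ 2 := by nlinarith [hs.1]
  gcongr

theorem hasDerivAt_half_log_sq_add_sq {y : ℝ} (hy : 0 < y) (t : ℝ) :
    HasDerivAt (fun t => Real.log (t ^ 2 + y ^ 2) / 2) (t / (t ^ 2 + y ^ 2)) t := by
  have hT : t ^ 2 + y ^ 2 ≠ 0 := by positivity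
  convert! ((((hasDerivAt_id t).pow 2).add_const (y ^ 2)).log hT).div_const 2 using 1
  simp; field_simp

theorem summable_one_div_sq_add_sq {y : ℝ} (hy : 0 < y) :
    Summable fun j : ℕ => 1 / ((j : ℝ) ^ 2 + y ^ 2) := by
  refine Summable.of_norm_bounded_eventually_nat
    (Real.summable_one_div_nat_pow.2 (by norm_num : 1 < 2)) ?_
  filter_upwards [eventually_gt_atTop 0] with j hj
  rw [Real.norm_of_nonneg (by positivity)]
  have : (0 : ℝ) < j := by exact_mod_cast hj
  gcongr
  nlinarith [sq_nonneg y]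

theorem tendsto_tsum_one_div_sq_add_sq :
    Tendsto (fun y : ℝ => ∑' j : ℕ, 1 / ((j : ℝ) ^ 2 + y ^ 2)) atTop (𝓝 0) := by
  -- The terms decrease in `y`, so the series at `y = 1` dominates.
  have := tendsto_tsum_of_dominated_convergence (𝓕 := atTop)
    (f := fun (y : ℝ) (j : ℕ) => 1 / ((j : ℝ) ^ 2 + y ^ 2)) (g := fun _ => 0)
    (summable_one_div_sq_add_sq one_pos) (fun j => ?_) ?_
  · simpa using this
  · refine Tendsto.div_atTop tendsto_const_nhds ?_
    exact tendsto_atTop_add_const_left _ _ (tendsto_pow_atTop two_ne_zero)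
  · filter_upwards [eventually_ge_atTop 1] with y hy j
    rw [Real.norm_of_nonneg (by positivity)]
    gcongr

/-! ### The complex Gamma function on vertical lines -/

namespace Complex

theorem log_norm_GammaSeq {x y : ℝ} (hy : 0 < y) {n : ℕ} (hn : n ≠ 0) :
    Real.log ‖GammaSeq (x + y * I) n‖ = x * Real.log n + Real.log n.factorial -
      ∑ j ∈ Finset.range (n + 1), Real.log (((j : ℝ) + x) ^ 2 + y ^ 2) / 2 := by
  have hterm : ∀ j : ℕ, Real.log ‖(x + y * I : ℂ) + j‖ =
      Real.log (((j : ℝ) + x) ^ 2 + y ^ 2) / 2 := fun j => by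
    rw [Complex.norm_def, Real.log_sqrt (normSq_nonneg _), normSq_apply]
    simp; ring_nf
  have hne : ∀ j : ℕ, ‖(x + y * I : ℂ) + j‖ ≠ 0 := fun j h => by
    have := congrArg im (norm_eq_zero.1 h)
    simp at this; exact hy.ne' this
  have hn' : (0 : ℝ) < n := by exact_mod_cast Nat.pos_of_ne_zero hn
  rw [GammaSeq, norm_div, norm_mul, norm_prod, Real.log_div, Real.log_mul, Real.log_prod]
  · congr 1
    · congr 1
      · rw [← ofReal_natCast, norm_cpow_eq_rpow_re_of_pos hn', Real.log_rpow hn']; simp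
      · simp
    · exact Finset.sum_congr rfl fun j _ => hterm j
  · exact fun j _ => hne j
  · rw [← ofReal_natCast, norm_cpow_eq_rpow_re_of_pos hn']; positivity
  · simp [Nat.factorial_ne_zero]
  · rw [← ofReal_natCast, norm_cpow_eq_rpow_re_of_pos hn']
    have := Nat.factorial_pos n
    simp only [RCLike.norm_natCast]; positivity
  · exact Finset.prod_ne_zero_iff.2 fun j _ => hne j

theorem Gamma_add_mul_I_ne_zero (x : ℝ) {y : ℝ} (hy : y ≠ 0) : Gamma (x + y * I) ≠ 0 :=
  Gamma_ne_zero fun m h => hy (by simpa using congrArg im h)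

/-- In the logarithm of Euler's product, `x log n + log n!` is affine in `x` and cancels. Each
remaining factor costs at most `1/(j² + y²)`; this bound is uniform in `n` and survives the limit.
-/
theorem abs_log_norm_Gamma_sub_lerp_le {x y : ℝ} (hx0 : 0 ≤ x) (hx1 : x ≤ 1) (hy : 0 < y) :
    |Real.log ‖Gamma (x + y * I)‖ - ((1 - x) * Real.log ‖Gamma ((0 : ℝ) + y * I)‖ +
      x * Real.log ‖Gamma ((1 : ℝ) + y * I)‖)| ≤ ∑' j : ℕ, 1 / ((j : ℝ) ^ 2 + y ^ 2) := by
  have hlim : ∀ x : ℝ, Tendsto (fun n => Real.log ‖GammaSeq (x + y * I) n‖) atTop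
      (𝓝 (Real.log ‖Gamma (x + y * I)‖)) := fun x =>
    ((GammaSeq_tendsto_Gamma _).norm).log (norm_ne_zero_iff.2 (Gamma_add_mul_I_ne_zero x hy.ne'))
  refine le_of_tendsto (((hlim x).sub (((hlim 0).const_mul (1 - x)).add
    ((hlim 1).const_mul x))).abs) ?_
  filter_upwards [eventually_ne_atTop 0] with n hn
  rw [log_norm_GammaSeq hy hn, log_norm_GammaSeq hy hn, log_norm_GammaSeq hy hn]
  have hsum : x * Real.log n + Real.log n.factorial -
      ∑ j ∈ Finset.range (n + 1), Real.log (((j : ℝ) + x) ^ 2 + y ^ 2) / 2 -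
      ((1 - x) * (0 * Real.log n + Real.log n.factorial -
        ∑ j ∈ Finset.range (n + 1), Real.log (((j : ℝ) + 0) ^ 2 + y ^ 2) / 2) +
      x * (1 * Real.log n + Real.log n.factorial -
        ∑ j ∈ Finset.range (n + 1), Real.log (((j : ℝ) + 1) ^ 2 + y ^ 2) / 2)) =
      -∑ j ∈ Finset.range (n + 1), (Real.log (((j : ℝ) + x) ^ 2 + y ^ 2) / 2 -
        ((1 - x) * (Real.log ((j : ℝ) ^ 2 + y ^ 2) / 2) +
          x * (Real.log (((j : ℝ) + 1) ^ 2 + y ^ 2) / 2))) := by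
    simp only [add_zero, Finset.sum_sub_distrib, Finset.sum_add_distrib, ← Finset.mul_sum]
    ring
  rw [hsum, abs_neg]
  refine (Finset.abs_sum_le_sum_abs _ _).trans ?_
  refine (Finset.sum_le_sum fun j _ => ?_).trans
    ((summable_one_div_sq_add_sq hy).sum_le_tsum _ fun j _ => by positivity)
  exact abs_sub_lerp_le (hasDerivAt_half_log_sq_add_sq hy)
    (fun s hs t ht => abs_div_sq_add_sq_sub_le j.cast_nonneg hy hs ht) hx0 hx1

/-- The model `(2π)^{1/2} y^{x-1/2} e^{-πy/2}` for `|Γ(x + iy)|`. -/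
noncomputable def stirlingModel (x y : ℝ) : ℝ :=
  Real.sqrt (2 * Real.pi) * y ^ (x - 1 / 2) * Real.exp (-Real.pi * y / 2)

theorem stirlingModel_pos (x : ℝ) {y : ℝ} (hy : 0 < y) : 0 < stirlingModel x y := by
  unfold stirlingModel; positivity

theorem stirlingModel_add_one (x : ℝ) {y : ℝ} (hy : 0 < y) :
    stirlingModel (x + 1) y = y * stirlingModel x y := by
  rw [stirlingModel, stirlingModel, show x + 1 - 1 / 2 = (x - 1 / 2) + 1 by ring,
    Real.rpow_add_one hy.ne']
  ring

/-- The reflection formula at `iy`, where `Γ(1 - iy) = -iy Γ(-iy)` and `Γ(-iy)` is the conjugate of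
`Γ(iy)`. -/
theorem norm_Gamma_mul_I_sq {y : ℝ} (hy : 0 < y) :
    ‖Gamma (y * I)‖ ^ 2 = Real.pi / (y * Real.sinh (Real.pi * y)) := by
  have h1 := Gamma_mul_Gamma_one_sub (y * I)
  have h2 : Gamma (1 - y * I) = -(y * I) * Gamma (-(y * I)) := by
    rw [← Gamma_add_one _ (by simp [hy.ne'])]; congr 1; ring
  have h3 : Gamma (-(y * I)) = (starRingEnd ℂ) (Gamma (y * I)) := by
    rw [← Gamma_conj]; simp
  rw [h2, h3, ← mul_assoc (Real.pi : ℂ), sin_mul_I] at h1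
  have h4 := congrArg norm h1
  have h5 : 0 < Real.sinh (Real.pi * y) := Real.sinh_pos_iff.2 (by positivity)
  rw [← ofReal_mul, ← ofReal_sinh] at h4
  simp only [norm_mul, norm_neg, norm_real, norm_I, RCLike.norm_conj, norm_div, Real.norm_eq_abs,
    abs_of_pos hy, abs_of_pos h5, abs_of_pos Real.pi_pos, mul_one] at h4
  rw [eq_div_iff (by positivity)]
  rw [eq_div_iff h5.ne'] at h4
  linarith

/-- The square of the quotient is exactly `1 / (1 - e^{-2πy})`. -/
theorem tendsto_norm_Gamma_mul_I_div :
    Tendsto (fun y : ℝ => ‖Gamma ((0 : ℝ) + y * I)‖ / stirlingModel 0 y) atTop (𝓝 1) := by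
  have h1 : Tendsto (fun y : ℝ => Real.sqrt (1 / (1 - Real.exp (-(2 * Real.pi * y))))) atTop
      (𝓝 1) := by
    have h2 : Tendsto (fun y : ℝ => Real.exp (-(2 * Real.pi * y))) atTop (𝓝 0) :=
      Real.tendsto_exp_neg_atTop_nhds_zero.comp (tendsto_id.const_mul_atTop (by positivity))
    have h3 := (((tendsto_const_nhds (x := (1 : ℝ))).div (h2.const_sub 1) (by norm_num)).sqrt)
    simpa using h3
  refine h1.congr' ?_
  filter_upwards [eventually_gt_atTop 0] with y hy
  rw [← Real.sqrt_sq (show 0 ≤ ‖Gamma ((0 : ℝ) + y * I)‖ / stirlingModel 0 y from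
    div_nonneg (norm_nonneg _) (stirlingModel_pos 0 hy).le)]
  congr 1
  have h4 : stirlingModel 0 y ^ 2 = 2 * Real.pi * y⁻¹ * Real.exp (-(Real.pi * y)) := by
    rw [stirlingModel, mul_pow, mul_pow, Real.sq_sqrt (by positivity), ← Real.exp_nat_mul,
      ← Real.rpow_natCast (y ^ _), ← Real.rpow_mul hy.le]
    norm_num [Real.rpow_neg_one]
    left; ring
  have h5 : Real.exp (-(2 * Real.pi * y)) = Real.exp (-(Real.pi * y)) * Real.exp (-(Real.pi * y)) := by
    rw [← Real.exp_add]; ring_nf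
  have h6 : Real.exp (-(Real.pi * y)) < 1 := Real.exp_lt_one_iff.2 (by nlinarith [Real.pi_pos])
  have h7 := Real.exp_pos (-(Real.pi * y))
  rw [div_pow, h4, ofReal_zero, zero_add, norm_Gamma_mul_I_sq hy, h5, Real.sinh_eq,
    show Real.exp (Real.pi * y) = (Real.exp (-(Real.pi * y)))⁻¹ by rw [← Real.exp_neg]; simp]
  set e := Real.exp (-(Real.pi * y))
  have h8 : 1 - e * e ≠ 0 := by nlinarith
  have h9 : e⁻¹ - e ≠ 0 := by
    intro h; apply h8; field_simp at h; linarith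
  field_simp

theorem tendsto_norm_add_mul_I_div (x : ℝ) :
    Tendsto (fun y : ℝ => ‖(x + y * I : ℂ)‖ / y) atTop (𝓝 1) := by
  have h1 : Tendsto (fun y : ℝ => Real.sqrt ((x / y) ^ 2 + 1)) atTop (𝓝 1) := by
    have := ((((tendsto_const_nhds (x := x)).div_atTop tendsto_id).pow 2).add_const 1).sqrt
    simpa using this
  refine h1.congr' ?_
  filter_upwards [eventually_gt_atTop 0] with y hy
  rw [norm_add_mul_I, eq_div_iff hy.ne', ← Real.sqrt_sq hy.le, ← Real.sqrt_mul (by positivity),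
    Real.sqrt_sq hy.le]
  congr 1; field_simp

/-- The two quotients differ by the factor `|x + iy| / y → 1`. Both directions are needed to reach
every real `x` from `[0, 1]`. -/
theorem tendsto_norm_Gamma_div_add_one_iff (x : ℝ) :
    Tendsto (fun y : ℝ => ‖Gamma ((x + 1 : ℝ) + y * I)‖ / stirlingModel (x + 1) y) atTop (𝓝 1) ↔
      Tendsto (fun y : ℝ => ‖Gamma (x + y * I)‖ / stirlingModel x y) atTop (𝓝 1) := by
  have h : ∀ᶠ y : ℝ in atTop, ‖Gamma ((x + 1 : ℝ) + y * I)‖ / stirlingModel (x + 1) y =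
      ‖(x + y * I : ℂ)‖ / y * (‖Gamma (x + y * I)‖ / stirlingModel x y) := by
    filter_upwards [eventually_gt_atTop 0] with y hy
    have hne : (x + y * I : ℂ) ≠ 0 := fun h => hy.ne' (by simpa using congrArg im h)
    rw [show ((x + 1 : ℝ) + y * I : ℂ) = (x + y * I) + 1 by push_cast; ring, Gamma_add_one _ hne,
      norm_mul, stirlingModel_add_one x hy, mul_div_mul_comm]
  rw [tendsto_congr' h]
  constructor
  · intro H
    have := H.div (tendsto_norm_add_mul_I_div x) one_ne_zero
    rw [div_one] at this
    refine this.congr' ?_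
    filter_upwards [eventually_gt_atTop 0] with y hy
    have hne : (x + y * I : ℂ) ≠ 0 := fun h => hy.ne' (by simpa using congrArg im h)
    have : ‖(x + y * I : ℂ)‖ / y ≠ 0 := div_ne_zero (norm_ne_zero_iff.2 hne) hy.ne'
    simp only [Pi.div_apply]
    field_simp
  · intro H
    simpa using (tendsto_norm_add_mul_I_div x).mul H

theorem tendsto_norm_Gamma_div_of_mem {x : ℝ} (hx0 : 0 ≤ x) (hx1 : x ≤ 1) :
    Tendsto (fun y : ℝ => ‖Gamma (x + y * I)‖ / stirlingModel x y) atTop (𝓝 1) := by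
  have h0 := tendsto_norm_Gamma_mul_I_div
  have h1 := (tendsto_norm_Gamma_div_add_one_iff 0).2 h0
  rw [zero_add] at h1
  have hd : Tendsto (fun y : ℝ => Real.log ‖Gamma (x + y * I)‖ -
      ((1 - x) * Real.log ‖Gamma ((0 : ℝ) + y * I)‖ + x * Real.log ‖Gamma ((1 : ℝ) + y * I)‖))
      atTop (𝓝 0) := by
    refine squeeze_zero_norm' ?_ tendsto_tsum_one_div_sq_add_sq
    filter_upwards [eventually_gt_atTop 0] with y hy
    exact abs_log_norm_Gamma_sub_lerp_le hx0 hx1 hy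
  -- Since the logarithm of the model is affine in `x`, the logarithm of the quotient at `x` is the
  -- interpolation defect plus the interpolated logarithms of the quotients at 0 and 1.
  have h2 := (hd.add (((h0.log one_ne_zero).const_mul (1 - x)).add
    ((h1.log one_ne_zero).const_mul x))).rexp
  simp only [Real.log_one, mul_zero, add_zero, Real.exp_zero] at h2
  refine h2.congr' ?_
  filter_upwards [eventually_gt_atTop 0] with y hy
  have hm := fun x => (stirlingModel_pos x hy).ne'
  have hG := fun x => norm_ne_zero_iff.2 (Gamma_add_mul_I_ne_zero x hy.ne')
  have hlog : ∀ x, Real.log (stirlingModel x y) = Real.log (Real.sqrt (2 * Real.pi)) +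
      (x - 1 / 2) * Real.log y + (-Real.pi * y / 2) := fun x => by
    rw [stirlingModel, Real.log_mul (by positivity) (by positivity),
      Real.log_mul (by positivity) (by positivity), Real.log_exp, Real.log_rpow hy]
  rw [Real.log_div (hG 0) (hm 0), Real.log_div (hG 1) (hm 1),
    ← Real.exp_log (div_pos (norm_pos_iff.2 (Gamma_add_mul_I_ne_zero x hy.ne'))
      (stirlingModel_pos x hy)), Real.log_div (hG x) (hm x), hlog, hlog, hlog]
  congr 1
  ring

/-- Stirling's formula for the modulus of the Gamma function on vertical lines. -/
theorem tendsto_norm_Gamma_div (x : ℝ) :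
    Tendsto (fun y : ℝ => ‖Gamma (x + y * I)‖ / stirlingModel x y) atTop (𝓝 1) := by
  have key : ∀ m : ℤ, Tendsto (fun y : ℝ => ‖Gamma ((Int.fract x + m : ℝ) + y * I)‖ /
      stirlingModel (Int.fract x + m) y) atTop (𝓝 1) := fun m => by
    induction m using Int.induction_on with
    | zero =>
      simpa using tendsto_norm_Gamma_div_of_mem (Int.fract_nonneg x) (Int.fract_lt_one x).le
    | succ i hi =>
      have := (tendsto_norm_Gamma_div_add_one_iff _).2 hi
      rw [add_assoc] at this
      exact_mod_cast this
    | pred i hi =>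
      refine (tendsto_norm_Gamma_div_add_one_iff _).1 ?_
      have h : Int.fract x + ((-(i : ℤ) - 1 : ℤ) : ℝ) + 1 = Int.fract x + ((-(i : ℤ) : ℤ) : ℝ) := by
        push_cast; ring
      rwa [h]
  simpa [Int.fract_add_floor] using key ⌊x⌋

theorem norm_Gamma_add_mul_abs_I (x y : ℝ) :
    ‖Gamma (x + (|y| : ℝ) * I)‖ = ‖Gamma (x + y * I)‖ := by
  rcases abs_choice y with h | h
  · rw [h]
  · rw [h, ← RCLike.norm_conj, ← Gamma_conj]; simp

end Complex

/-! ### Algebra of the Cayley-Dickson numbers -/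

namespace CayleyDickson

variable {v : ℕ}

theorem pair_ext {z w : CayleyDickson (v + 1)} (hl : left z = left w) (hr : right z = right w) :
    z = w :=
  (WithLp.ofLp_injective 2) (Prod.ext hl hr)

@[simp] theorem left_pair (a b : CayleyDickson v) : left (pair a b) = a := rfl
@[simp] theorem right_pair (a b : CayleyDickson v) : right (pair a b) = b := rfl
@[simp] theorem left_zero : left (0 : CayleyDickson (v + 1)) = 0 := rfl
@[simp] theorem right_zero : right (0 : CayleyDickson (v + 1)) = 0 := rfl
@[simp] theorem left_one : left (1 : CayleyDickson (v + 1)) = 1 := rfl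
@[simp] theorem right_one : right (1 : CayleyDickson (v + 1)) = 0 := rfl
@[simp] theorem left_add (z w : CayleyDickson (v + 1)) : left (z + w) = left z + left w := rfl
@[simp] theorem right_add (z w : CayleyDickson (v + 1)) : right (z + w) = right z + right w := rfl
@[simp] theorem left_sub (z w : CayleyDickson (v + 1)) : left (z - w) = left z - left w := rfl
@[simp] theorem right_sub (z w : CayleyDickson (v + 1)) : right (z - w) = right z - right w := rfl
@[simp] theorem left_smul (c : ℝ) (z : CayleyDickson (v + 1)) :
    left (c • z) = c • left z := rfl
@[simp] theorem right_smul (c : ℝ) (z : CayleyDickson (v + 1)) :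
    right (c • z) = c • right z := rfl
@[simp] theorem left_conj (z : CayleyDickson (v + 1)) : left (conj z) = conj (left z) := rfl
@[simp] theorem right_conj (z : CayleyDickson (v + 1)) : right (conj z) = -right z := rfl
@[simp] theorem left_mul (z w : CayleyDickson (v + 1)) :
    left (z * w) = left z * left w - conj (right w) * right z := rfl
@[simp] theorem right_mul (z w : CayleyDickson (v + 1)) :
    right (z * w) = right w * left z + right z * conj (left w) := rfl

@[simp] theorem conj_add (z w : CayleyDickson v) : conj (z + w) = conj z + conj w := by
  induction v with
  | zero => rfl
  | succ v ih => exact pair_ext (ih _ _) (neg_add _ _)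

@[simp] theorem conj_smul (c : ℝ) (z : CayleyDickson v) : conj (c • z) = c • conj z := by
  induction v with
  | zero => rfl
  | succ v ih => exact pair_ext (ih _) (smul_neg _ _).symm

@[simp] theorem conj_zero : conj (0 : CayleyDickson v) = 0 := by
  simpa using conj_smul 0 (0 : CayleyDickson v)

@[simp] theorem conj_neg (z : CayleyDickson v) : conj (-z) = -conj z := by
  simpa using conj_smul (-1) z

@[simp] theorem conj_one : conj (1 : CayleyDickson v) = 1 := by
  induction v with
  | zero => rfl
  | succ v ih => exact pair_ext ih (by simp)

@[simp] theorem conj_conj (z : CayleyDickson v) : conj (conj z) = z := by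
  induction v with
  | zero => rfl
  | succ v ih => exact pair_ext (ih _) (neg_neg _)

/-- Doubling reverses some factors, so each distributive law uses both laws one level below; they
are proved together. -/
theorem add_mul_and_mul_add (z w u : CayleyDickson v) :
    (z + w) * u = z * u + w * u ∧ u * (z + w) = u * z + u * w := by
  induction v with
  | zero => exact ⟨add_mul (R := ℝ) z w u, mul_add (R := ℝ) u z w⟩
  | succ v ih =>
    refine ⟨pair_ext ?_ ?_, pair_ext ?_ ?_⟩ <;>
    · simp only [left_mul, left_add, right_mul, right_add, conj_add, (ih _ _ _).1, (ih _ _ _).2]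
      abel

theorem smul_mul_and_mul_smul (c : ℝ) (z w : CayleyDickson v) :
    (c • z) * w = c • (z * w) ∧ z * (c • w) = c • (z * w) := by
  induction v with
  | zero => exact ⟨mul_assoc (G := ℝ) c z w, mul_left_comm (G := ℝ) z c w⟩
  | succ v ih =>
    refine ⟨pair_ext ?_ ?_, pair_ext ?_ ?_⟩ <;>
    simp only [left_mul, left_smul, right_mul, right_smul, conj_smul, (ih _ _).1, (ih _ _).2,
      smul_sub, smul_add]

theorem zero_mul_and_mul_zero (z : CayleyDickson v) : 0 * z = 0 ∧ z * 0 = 0 := by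
  have h := smul_mul_and_mul_smul 0 z 0
  have h' := smul_mul_and_mul_smul 0 0 z
  simp only [zero_smul] at h h'
  exact ⟨h'.1, h.2⟩

theorem one_mul_and_mul_one (z : CayleyDickson v) : 1 * z = z ∧ z * 1 = z := by
  induction v with
  | zero => exact ⟨one_mul (M := ℝ) z, mul_one (M := ℝ) z⟩
  | succ v ih =>
    refine ⟨pair_ext ?_ ?_, pair_ext ?_ ?_⟩ <;>
    simp [(ih _).1, (ih _).2, (zero_mul_and_mul_zero _).1, (zero_mul_and_mul_zero _).2]

noncomputable scoped instance instNonAssocRing (v : ℕ) : NonAssocRing (CayleyDickson v) where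
  __ := (instNormedAddCommGroup v).toAddCommGroup
  __ := (inferInstance : Mul (CayleyDickson v))
  __ := (inferInstance : One (CayleyDickson v))
  left_distrib u z w := (add_mul_and_mul_add z w u).2
  right_distrib z w u := (add_mul_and_mul_add z w u).1
  zero_mul z := (zero_mul_and_mul_zero z).1
  mul_zero z := (zero_mul_and_mul_zero z).2
  one_mul z := (one_mul_and_mul_one z).1
  mul_one z := (one_mul_and_mul_one z).2

scoped instance : IsScalarTower ℝ (CayleyDickson v) (CayleyDickson v) :=
  ⟨fun c z w => (smul_mul_and_mul_smul c z w).1⟩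

scoped instance : SMulCommClass ℝ (CayleyDickson v) (CayleyDickson v) :=
  ⟨fun c z w => ((smul_mul_and_mul_smul c z w).2).symm⟩

/-- The component `a` of `a + b l`, as a linear map. -/
def leftLinear (v : ℕ) : CayleyDickson (v + 1) →ₗ[ℝ] CayleyDickson v where
  toFun := left
  map_add' _ _ := rfl
  map_smul' _ _ := rfl

/-- The component `b` of `a + b l`, as a linear map. -/
def rightLinear (v : ℕ) : CayleyDickson (v + 1) →ₗ[ℝ] CayleyDickson v where
  toFun := right
  map_add' _ _ := rfl
  map_smul' _ _ := rfl

/-- The real part as a real number. -/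
noncomputable def realPart : (v : ℕ) → CayleyDickson v →ₗ[ℝ] ℝ
  | 0 => (LinearMap.id : ℝ →ₗ[ℝ] ℝ)
  | v + 1 => realPart v ∘ₗ leftLinear v

@[simp] theorem realPart_succ (z : CayleyDickson (v + 1)) :
    realPart (v + 1) z = realPart v (left z) := rfl

@[simp] theorem realPart_one : realPart v 1 = 1 := by
  induction v with
  | zero => rfl
  | succ v ih => exact ih

theorem add_conj (z : CayleyDickson v) : z + conj z = (2 * realPart v z) • (1 : CayleyDickson v) := by
  induction v with
  | zero =>
    have : ∀ t : ℝ, t + t = 2 * t * 1 := fun t => by ring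
    exact this z
  | succ v ih => exact pair_ext (by simpa using ih _) (by simp)

theorem re_eq (z : CayleyDickson v) : re z = realPart v z • (1 : CayleyDickson v) := by
  rw [re, add_conj, smul_smul]; congr 1; ring

theorem mem_imaginary_iff {z : CayleyDickson v} : z ∈ imaginary v ↔ realPart v z = 0 := by
  constructor
  · intro h
    have h2 : realPart v z • (1 : CayleyDickson v) = 0 := (re_eq z).symm.trans h
    simpa using congrArg (realPart v) h2
  · intro h
    exact (re_eq z).trans (by simp [h])

theorem conj_of_mem_imaginary {z : CayleyDickson v} (hz : z ∈ imaginary v) : conj z = -z := by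
  have := add_conj z
  rw [mem_imaginary_iff.1 hz] at this
  simpa using eq_neg_of_add_eq_zero_right (by simpa using this)

theorem norm_sq_eq (z : CayleyDickson (v + 1)) : ‖z‖ ^ 2 = ‖left z‖ ^ 2 + ‖right z‖ ^ 2 :=
  WithLp.prod_norm_sq_eq_of_L2 (α := CayleyDickson v) (β := CayleyDickson v) z

theorem conj_mul_self_and_mul_conj_self (z : CayleyDickson v) :
    conj z * z = ‖z‖ ^ 2 • (1 : CayleyDickson v) ∧ z * conj z = ‖z‖ ^ 2 • (1 : CayleyDickson v) := by
  induction v with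
  | zero =>
    have : ∀ t : ℝ, t * t = |t| ^ 2 * 1 := fun t => by rw [sq_abs]; ring
    exact ⟨this z, this z⟩
  | succ v ih =>
    refine ⟨pair_ext ?_ ?_, pair_ext ?_ ?_⟩ <;>
    simp [norm_sq_eq, (ih _).1, (ih _).2, add_smul]

theorem mul_conj_self (z : CayleyDickson v) : z * conj z = ‖z‖ ^ 2 • (1 : CayleyDickson v) :=
  (conj_mul_self_and_mul_conj_self z).2

@[simp] theorem norm_one : ‖(1 : CayleyDickson v)‖ = 1 := by
  have h := congrArg (realPart v) (mul_conj_self (1 : CayleyDickson v))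
  simp at h
  have := norm_nonneg (1 : CayleyDickson v)
  nlinarith

/-! ### Complex slices -/

/-- The map `a + b i ↦ a + b M` from the complex numbers. -/
noncomputable def ofComplex (M : CayleyDickson v) : ℂ →L[ℝ] CayleyDickson v :=
  Complex.reCLM.smulRight 1 + Complex.imCLM.smulRight M

theorem ofComplex_apply (M : CayleyDickson v) (w : ℂ) :
    ofComplex M w = w.re • (1 : CayleyDickson v) + w.im • M := rfl

@[simp] theorem ofComplex_one (M : CayleyDickson v) : ofComplex M 1 = 1 := by
  simp [ofComplex_apply]

theorem realPart_ofComplex {M : CayleyDickson v} (hM : M ∈ imaginary v) (w : ℂ) :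
    realPart v (ofComplex M w) = w.re := by
  simp [ofComplex_apply, mem_imaginary_iff.1 hM]

theorem mul_self_of_mem_imaginary {M : CayleyDickson v} (hM : M ∈ imaginary v) (h1 : ‖M‖ = 1) :
    M * M = -1 := by
  have := mul_conj_self M
  rw [conj_of_mem_imaginary hM, h1] at this
  simpa [neg_eq_iff_eq_neg] using this

theorem ofComplex_mul {M : CayleyDickson v} (hM : M ∈ imaginary v) (h1 : ‖M‖ = 1) (w u : ℂ) :
    ofComplex M (w * u) = ofComplex M w * ofComplex M u := by
  simp only [ofComplex_apply, add_mul, mul_add, smul_mul_assoc, mul_smul_comm, one_mul, mul_one,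
    mul_self_of_mem_imaginary hM h1, Complex.mul_re, Complex.mul_im]
  module

theorem conj_ofComplex {M : CayleyDickson v} (hM : M ∈ imaginary v) (w : ℂ) :
    conj (ofComplex M w) = ofComplex M ((starRingEnd ℂ) w) := by
  simp [ofComplex_apply, conj_of_mem_imaginary hM]

theorem norm_ofComplex {M : CayleyDickson v} (hM : M ∈ imaginary v) (h1 : ‖M‖ = 1) (w : ℂ) :
    ‖ofComplex M w‖ = ‖w‖ := by
  have h := congrArg (realPart v) (mul_conj_self (ofComplex M w))
  rw [conj_ofComplex hM, ← ofComplex_mul hM h1, realPart_ofComplex hM, Complex.mul_conj] at h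
  simp only [Complex.ofReal_re, map_smul, realPart_one, smul_eq_mul, mul_one,
    Complex.normSq_eq_norm_sq] at h
  exact ((sq_eq_sq₀ (norm_nonneg _) (norm_nonneg _)).1 h).symm

theorem npow_ofComplex {M : CayleyDickson v} (hM : M ∈ imaginary v) (h1 : ‖M‖ = 1) (w : ℂ)
    (n : ℕ) : npow (ofComplex M w) n = ofComplex M (w ^ n) := by
  induction n with
  | zero => simp [npow]
  | succ n ih => rw [npow, ih, pow_succ, ofComplex_mul hM h1]

theorem exp_ofComplex {M : CayleyDickson v} (hM : M ∈ imaginary v) (h1 : ‖M‖ = 1) (w : ℂ) :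
    exp (ofComplex M w) = ofComplex M (Complex.exp w) := by
  have h : HasSum (fun n : ℕ => ((n.factorial : ℝ)⁻¹) • w ^ n) (Complex.exp w) := by
    rw [Complex.exp_eq_exp_ℂ]
    exact NormedSpace.exp_series_hasSum_exp' (𝕂 := ℝ) w
  have h2 := h.mapL (ofComplex M)
  simp only [map_smul, ← npow_ofComplex hM h1] at h2
  exact h2.tsum_eq

theorem gammaIntegrand_ofComplex {M : CayleyDickson v} (hM : M ∈ imaginary v) (h1 : ‖M‖ = 1)
    (w : ℂ) {t : ℝ} (ht : 0 < t) :
    gammaIntegrand (ofComplex M w) t = ofComplex M (Real.exp (-t) * (t : ℂ) ^ (w - 1)) := by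
  rw [gammaIntegrand, rpow, ← ofComplex_one M, ← map_sub, ← map_smul, exp_ofComplex hM h1,
    ← map_smul, Complex.cpow_def_of_ne_zero (by exact_mod_cast ht.ne'), ← Complex.ofReal_log ht.le]
  simp

/-- The point `a + b i` of the closed upper half plane that has the real part of `z` and the modulus
of the imaginary part of `z`. -/
noncomputable def toComplex (z : CayleyDickson v) : ℂ :=
  ⟨realPart v z, ‖z - realPart v z • (1 : CayleyDickson v)‖⟩

theorem exists_imaginary_unit (v : ℕ) :
    ∃ M : CayleyDickson (v + 1), M ∈ imaginary (v + 1) ∧ ‖M‖ = 1 := by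
  refine ⟨pair 0 1, mem_imaginary_iff.2 (by simp), ?_⟩
  have := norm_sq_eq (pair 0 1 : CayleyDickson (v + 1))
  simp at this
  rcases this with h | h
  · exact h
  · have := norm_nonneg (pair 0 1 : CayleyDickson (v + 1)); linarith

theorem exists_ofComplex_toComplex (hv : 1 ≤ v) (z : CayleyDickson v) :
    ∃ M : CayleyDickson v, M ∈ imaginary v ∧ ‖M‖ = 1 ∧ z = ofComplex M (toComplex z) := by
  set w := z - realPart v z • (1 : CayleyDickson v) with hw
  by_cases h : w = 0
  · obtain ⟨v, rfl⟩ : ∃ u, v = u + 1 := ⟨v - 1, by omega⟩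
    obtain ⟨M, hM, h1⟩ := exists_imaginary_unit v
    refine ⟨M, hM, h1, ?_⟩
    simp only [ofComplex_apply, toComplex, ← hw, h]
    simpa using sub_eq_zero.1 h
  · have hn : ‖w‖ ≠ 0 := norm_ne_zero_iff.2 h
    refine ⟨‖w‖⁻¹ • w, mem_imaginary_iff.2 ?_, ?_, ?_⟩
    · simp [hw]
    · rw [norm_smul, norm_inv, norm_norm, inv_mul_cancel₀ hn]
    · simp only [ofComplex_apply, toComplex, ← hw, smul_smul, mul_inv_cancel₀ hn, one_smul]
      simp [hw]

theorem exists_ofComplex (hv : 1 ≤ v) (z : CayleyDickson v) :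
    ∃ M : CayleyDickson v, M ∈ imaginary v ∧ ‖M‖ = 1 ∧ ∃ w : ℂ, z = ofComplex M w := by
  obtain ⟨M, hM, h1, h⟩ := exists_ofComplex_toComplex hv z
  exact ⟨M, hM, h1, _, h⟩

/-! ### Homogeneous polynomials -/

theorem IsHomogeneous.const_mul {m : ℕ} {P : CayleyDickson v → CayleyDickson v}
    (a : CayleyDickson v) (hP : IsHomogeneous m P) : IsHomogeneous m fun h => a * P h := by
  simpa using (IsHomogeneous.const a).mul hP

theorem IsHomogeneous.mul_const {m : ℕ} {P : CayleyDickson v → CayleyDickson v}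
    (a : CayleyDickson v) (hP : IsHomogeneous m P) : IsHomogeneous m fun h => P h * a := by
  simpa using hP.mul (IsHomogeneous.const a)

theorem IsHomogeneous.smul {m : ℕ} {P : CayleyDickson v → CayleyDickson v} (c : ℝ)
    (hP : IsHomogeneous m P) : IsHomogeneous m fun h => c • P h := by
  simpa using hP.const_mul (c • 1)

theorem IsHomogeneous.sub {m : ℕ} {P Q : CayleyDickson v → CayleyDickson v}
    (hP : IsHomogeneous m P) (hQ : IsHomogeneous m Q) : IsHomogeneous m fun h => P h - Q h := by
  simpa [sub_eq_add_neg] using hP.add (hQ.smul (-1))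

theorem IsHomogeneous.npow (m : ℕ) : IsHomogeneous m fun h : CayleyDickson v => npow h m := by
  induction m with
  | zero => exact .const 1
  | succ m ih => exact ih.mul .var

theorem IsHomogeneous.zero (m : ℕ) : IsHomogeneous m fun _ : CayleyDickson v => 0 := by
  simpa using (IsHomogeneous.npow (v := v) m).smul 0

theorem IsHomogeneous.sum {ι : Type*} (s : Finset ι) {m : ℕ}
    {P : ι → CayleyDickson v → CayleyDickson v}
    (hP : ∀ i ∈ s, IsHomogeneous m (P i)) : IsHomogeneous m fun h => ∑ i ∈ s, P i h := by
  classical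
  induction s using Finset.induction_on with
  | empty => simpa using IsHomogeneous.zero m
  | insert i s hi ih =>
    simp only [Finset.sum_insert hi]
    exact (hP i (by simp)).add (ih fun j hj => hP j (by simp [hj]))

theorem IsHomogeneous.map_smul {m : ℕ} {P : CayleyDickson v → CayleyDickson v}
    (hP : IsHomogeneous m P) (c : ℝ) (h : CayleyDickson v) : P (c • h) = c ^ m • P h := by
  induction hP with
  | const a => simp
  | var => simp
  | mul _ _ ih1 ih2 => simp only [ih1, ih2, smul_mul_assoc, mul_smul_comm, smul_smul, pow_add, mul_comm]
  | add _ _ ih1 ih2 => simp only [ih1, ih2, smul_add]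

/-- For `v ≥ 2` the real part is a homogeneous linear polynomial: with two anticommuting imaginary
units `l`, `e` one has `re z = (u - (e u) e) / 2`, where `u = (z - (l z) l) / 2`. -/
theorem isHomogeneous_realPart (hv : 2 ≤ v) :
    IsHomogeneous 1 fun h : CayleyDickson v => realPart v h • (1 : CayleyDickson v) := by
  obtain ⟨v, rfl⟩ : ∃ u, v = u + 1 + 1 := ⟨v - 2, by omega⟩
  set l : CayleyDickson (v + 1 + 1) := pair 0 1
  set e : CayleyDickson (v + 1 + 1) := pair (pair 0 1) 0
  have hu : IsHomogeneous 1 fun h : CayleyDickson (v + 1 + 1) => (1 / 2 : ℝ) • (h - (l * h) * l) :=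
    (IsHomogeneous.var.sub ((IsHomogeneous.var.const_mul l).mul_const l)).smul _
  -- `u` retains the real parts of both halves of `h`; the same operation with `e` then removes the
  -- `l` component.
  have hl : ∀ h : CayleyDickson (v + 1 + 1), (1 / 2 : ℝ) • (h - (l * h) * l) =
      pair (realPart (v + 1) (left h) • 1) (realPart (v + 1) (right h) • 1) := fun h => by
    have hre : ∀ z : CayleyDickson (v + 1),
        (1 / 2 : ℝ) • (z + conj z) = realPart (v + 1) z • (1 : CayleyDickson (v + 1)) := re_eq
    rw [← hre, ← hre]
    refine pair_ext ?_ ?_ <;> simp [l]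
  have he := (hu.sub ((hu.const_mul e).mul_const e)).smul (1 / 2)
  simp only [hl] at he
  convert! he using 2 with h
  refine pair_ext (pair_ext ?_ ?_) (pair_ext ?_ ?_) <;> simp [e]
  rw [← two_smul ℝ, smul_smul]; norm_num

/-- The form `re (a h)` is nondegenerate because `a a* = |a|²`, so in finite dimension it represents
every functional. -/
theorem exists_realPart_mul_eq (φ : CayleyDickson v →ₗ[ℝ] ℝ) :
    ∃ a : CayleyDickson v, ∀ h, φ h = realPart v (a * h) := by
  let B : CayleyDickson v →ₗ[ℝ] Module.Dual ℝ (CayleyDickson v) :=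
    LinearMap.mk₂ ℝ (fun a h => realPart v (a * h)) (by simp [add_mul]) (by simp [smul_mul_assoc])
      (by simp [mul_add]) (by simp [mul_smul_comm])
  have hinj : Function.Injective B := by
    rw [← LinearMap.ker_eq_bot, LinearMap.ker_eq_bot']
    intro a ha
    have h : realPart v (a * conj a) = 0 := congrArg (fun f => f (conj a)) ha
    rw [mul_conj_self] at h
    simpa using h
  obtain ⟨a, ha⟩ := (LinearMap.injective_iff_surjective_of_finrank_eq_finrank
    Subspace.dual_finrank_eq.symm).1 hinj φ
  exact ⟨a, fun h => by rw [← ha]; rfl⟩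

theorem isHomogeneous_comp_const_mul {m : ℕ} {P : CayleyDickson v → CayleyDickson v}
    (hP : IsHomogeneous m P) (a : CayleyDickson v) : IsHomogeneous m fun h => P (a * h) := by
  induction hP with
  | const b => exact .const b
  | var => exact IsHomogeneous.var.const_mul a
  | mul _ _ ih1 ih2 => exact ih1.mul ih2
  | add _ _ ih1 ih2 => exact ih1.add ih2

theorem isHomogeneous_linear (hv : 2 ≤ v) (φ : CayleyDickson v →ₗ[ℝ] ℝ) :
    IsHomogeneous 1 fun h : CayleyDickson v => φ h • (1 : CayleyDickson v) := by
  obtain ⟨a, ha⟩ := exists_realPart_mul_eq φ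
  simp only [ha]
  exact isHomogeneous_comp_const_mul (isHomogeneous_realPart hv) a

theorem isHomogeneous_prod (hv : 2 ≤ v) {n : ℕ} (φ : Fin n → CayleyDickson v →ₗ[ℝ] ℝ) :
    IsHomogeneous n fun h : CayleyDickson v => (∏ i, φ i h) • (1 : CayleyDickson v) := by
  induction n with
  | zero => simpa using IsHomogeneous.const 1
  | succ n ih =>
    have := (ih fun i => φ i.castSucc).mul (isHomogeneous_linear hv (φ (Fin.last n)))
    simpa [Fin.prod_univ_castSucc, smul_smul, mul_comm] using this

theorem isHomogeneous_multilinear (hv : 2 ≤ v) {n : ℕ}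
    (p : MultilinearMap ℝ (fun _ : Fin n => CayleyDickson v) (CayleyDickson v)) :
    IsHomogeneous n fun h => p fun _ => h := by
  let b := Module.finBasis ℝ (CayleyDickson v)
  have h1 : (fun h => p fun _ => h) = fun h => ∑ s : Fin n → Fin (Module.finrank ℝ (CayleyDickson v)),
      ((∏ i, b.coord (s i) h) • (1 : CayleyDickson v)) * p fun i => b (s i) := by
    funext h
    conv_lhs => rw [← b.sum_repr h]
    rw [p.map_sum]
    refine Finset.sum_congr rfl fun s _ => ?_
    rw [p.map_smul_univ, smul_mul_assoc, one_mul]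
    rfl
  rw [h1]
  exact IsHomogeneous.sum _ fun s _ => (isHomogeneous_prod hv _).mul_const _

/-- All real coordinates are homogeneous linear polynomials in the Cayley-Dickson variable, so every
term of a real Taylor series is an admissible polynomial. -/
theorem HolomorphicAt.of_analyticAt (hv : 2 ≤ v) {f : CayleyDickson v → CayleyDickson v}
    {c : CayleyDickson v} (hf : AnalyticAt ℝ f c) : HolomorphicAt f c := by
  obtain ⟨p, r, hp⟩ := hf
  obtain ⟨r', hr0, hr'⟩ := ENNReal.lt_iff_exists_nnreal_btwn.1 hp.r_pos
  refine ⟨r', by exact_mod_cast hr0, fun n h => p n fun _ => h,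
    fun n => isHomogeneous_multilinear hv (p n).toMultilinearMap, fun h hh => hp.hasSum ?_⟩
  rw [Metric.mem_eball, edist_zero_right]
  refine lt_trans ?_ hr'
  rw [← ofReal_norm, ENNReal.ofReal_lt_coe_iff (norm_nonneg _)]
  exact hh

/-- By homogeneity `P k (s u) = s^k P k u` for real `s`, so the series becomes an ordinary power
series in `s`. This makes the one-variable identity theorem available. -/
theorem HolomorphicAt.analyticAt_line {f : CayleyDickson v → CayleyDickson v} {c : CayleyDickson v}
    (hf : HolomorphicAt f c) (u : CayleyDickson v) :
    AnalyticAt ℝ (fun s : ℝ => f (c + s • u)) 0 := by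
  obtain ⟨r, hr, P, hP, hsum⟩ := hf
  obtain ⟨δ, hδ, hδu⟩ : ∃ δ : ℝ, 0 < δ ∧ δ * ‖u‖ < r := by
    refine ⟨r / (‖u‖ + 1), by positivity, ?_⟩
    rw [div_mul_eq_mul_div, div_lt_iff₀ (by positivity)]
    nlinarith [norm_nonneg u]
  let p : FormalMultilinearSeries ℝ ℝ (CayleyDickson v) := fun n =>
    ContinuousMultilinearMap.mkPiRing ℝ (Fin n) (P n u)
  have hs : ∀ s : ℝ, |s| ≤ δ → HasSum (fun n => s ^ n • P n u) (f (c + s • u)) := fun s hs => by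
    have := hsum (s • u) (by
      rw [norm_smul]; exact (mul_le_mul_of_nonneg_right hs (norm_nonneg u)).trans_lt hδu)
    simpa only [(hP _).map_smul] using this
  refine ⟨p, ENNReal.ofReal δ, ?_, by simpa using hδ, fun {s} hs' => ?_⟩
  · have h0 := (hs δ (abs_of_pos hδ).le).summable.tendsto_atTop_zero.norm
    rw [ENNReal.ofReal]
    refine p.le_radius_of_tendsto (l := 0) ?_
    simp only [norm_zero] at h0
    refine h0.congr fun n => ?_
    rw [norm_smul, Real.coe_toNNReal _ hδ.le, norm_pow, Real.norm_of_nonneg hδ.le]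
    simp [p, mul_comm]
  · have : |s| ≤ δ := by
      rw [Metric.mem_eball, edist_zero_right, ← ofReal_norm] at hs'
      exact ((ENNReal.ofReal_lt_ofReal_iff hδ).1 hs').le
    simpa [p] using hs s this

end CayleyDickson

/-! ### Power series of the complex Gamma function -/

theorem Complex.analyticAt_Gamma {s : ℂ} (hs : ∀ m : ℕ, s ≠ -m) : AnalyticAt ℂ Complex.Gamma s := by
  have h := (Complex.differentiable_one_div_Gamma.analyticAt s).inv
    (inv_ne_zero (Complex.Gamma_ne_zero hs))
  simpa [Pi.inv_def] using h

/-- The Taylor coefficients of the Gamma function at real points are real. -/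
theorem Complex.exists_real_hasSum_Gamma {a : ℝ} (ha : ∀ m : ℕ, a ≠ -m) :
    ∃ r : ℝ, 0 < r ∧ ∃ p : ℕ → ℝ, ∀ w : ℂ, ‖w‖ < r →
      HasSum (fun n => p n • w ^ n) (Complex.Gamma (a + w)) := by
  obtain ⟨p, r, hp⟩ := Complex.analyticAt_Gamma (s := a) fun m h => ha m (by exact_mod_cast h)
  obtain ⟨r', hr0, hr'⟩ := ENNReal.lt_iff_exists_nnreal_btwn.1 hp.r_pos
  refine ⟨r', by exact_mod_cast hr0, fun n => (p.coeff n).re, fun w hw => ?_⟩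
  have hsum : ∀ w : ℂ, ‖w‖ < r' → HasSum (fun n => p.coeff n * w ^ n) (Complex.Gamma (a + w)) :=
    fun w hw => by
      have := hp.hasSum (y := w) (by
        rw [Metric.mem_eball, edist_zero_right, ← ofReal_norm]
        exact ((ENNReal.ofReal_lt_coe_iff (norm_nonneg _)).2 hw).trans hr')
      simpa [FormalMultilinearSeries.apply_eq_pow_smul_coeff, mul_comm] using this
  have h1 := hsum w hw
  -- Conjugating the series at the conjugate of `w` gives the same value with conjugated
  -- coefficients; the average of both series has real coefficients.
  have h2 := (hsum ((starRingEnd ℂ) w) (by simpa using hw)).mapL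
    (Complex.conjCLE : ℂ →L[ℝ] ℂ)
  have h3 := (h1.add h2).const_smul (1 / 2 : ℝ)
  have e1 : (Complex.conjCLE : ℂ →L[ℝ] ℂ) (Complex.Gamma (a + (starRingEnd ℂ) w)) =
      Complex.Gamma (a + w) := by
    simp [← Complex.Gamma_conj]
  rw [e1, ← two_smul ℝ, smul_smul, one_div, inv_mul_cancel₀ two_ne_zero, one_smul] at h3
  have e2 : (fun n => (p.coeff n).re • w ^ n) = fun n => (1 / 2 : ℝ) • (p.coeff n * w ^ n +
      (Complex.conjCLE : ℂ →L[ℝ] ℂ) (p.coeff n * (starRingEnd ℂ) w ^ n)) := by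
    funext n
    have h4 : (((p.coeff n).re : ℝ) : ℂ) = (p.coeff n + (starRingEnd ℂ) (p.coeff n)) / 2 := by
      rw [Complex.add_conj]; push_cast; ring
    simp only [Complex.real_smul, h4, ContinuousLinearEquiv.coe_coe, Complex.conjCLE_apply,
      map_mul, map_pow, Complex.conj_conj]
    push_cast
    ring
  rw [e2]
  simpa using h3

/-! ### Existence of the Gamma function of `A_v` -/

namespace CayleyDickson

variable {v : ℕ}

theorem analyticAt_norm_sq (z : CayleyDickson v) :
    AnalyticAt ℝ (fun z : CayleyDickson v => ‖z‖ ^ 2) z := by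
  induction v with
  | zero =>
    have : (fun t : ℝ => ‖t‖ ^ 2) = fun t => t ^ 2 := by ext t; simp
    have h : AnalyticAt ℝ (fun t : ℝ => ‖t‖ ^ 2) z := by rw [this]; fun_prop
    exact h
  | succ v ih =>
    simp only [norm_sq_eq]
    exact ((ih _).comp (g := fun z : CayleyDickson v => ‖z‖ ^ 2)
        ((leftLinear v).toContinuousLinearMap.analyticAt z)).add
      ((ih _).comp (g := fun z : CayleyDickson v => ‖z‖ ^ 2)
        ((rightLinear v).toContinuousLinearMap.analyticAt z))

theorem analyticAt_norm {z : CayleyDickson v} (hz : z ≠ 0) :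
    AnalyticAt ℝ (fun z : CayleyDickson v => ‖z‖) z := by
  -- The exponent `⊤` means analytic here, not merely smooth.
  have h := ((analyticAt_norm_sq z).contDiffAt (n := ⊤)).sqrt
    (pow_ne_zero 2 (norm_ne_zero_iff.2 hz))
  simp only [Real.sqrt_sq (norm_nonneg _)] at h
  rw [← contDiffWithinAt_univ, contDiffWithinAt_omega_iff_analyticWithinAt,
    analyticWithinAt_univ] at h
  exact h

/-- The imaginary part, as a linear map. -/
noncomputable def imaginaryPart (v : ℕ) : CayleyDickson v →L[ℝ] CayleyDickson v :=
  (LinearMap.id - (realPart v).smulRight 1).toContinuousLinearMap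

theorem imaginaryPart_apply (z : CayleyDickson v) :
    imaginaryPart v z = z - realPart v z • (1 : CayleyDickson v) := rfl

theorem imaginaryPart_ofComplex {M : CayleyDickson v} (hM : M ∈ imaginary v) (w : ℂ) :
    imaginaryPart v (ofComplex M w) = w.im • M := by
  rw [imaginaryPart_apply, realPart_ofComplex hM, ofComplex_apply, add_sub_cancel_left]

theorem toComplex_ofComplex {M : CayleyDickson v} (hM : M ∈ imaginary v) (h1 : ‖M‖ = 1) (w : ℂ) :
    toComplex (ofComplex M w) = ⟨w.re, |w.im|⟩ := by
  rw [toComplex, ← imaginaryPart_apply, imaginaryPart_ofComplex hM, realPart_ofComplex hM,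
    norm_smul, h1, mul_one, Real.norm_eq_abs]

/-- The Gamma function of `A_v`, defined slice by slice from the complex Gamma function. -/
noncomputable def sliceGamma (z : CayleyDickson v) : CayleyDickson v :=
  (Complex.Gamma (toComplex z)).re • (1 : CayleyDickson v) +
    ((Complex.Gamma (toComplex z)).im / ‖imaginaryPart v z‖) • imaginaryPart v z

/-- `toComplex` forgets the sign of `w.im`; the conjugation symmetry of Γ restores it. On the real
axis Γ is real and the division by 0 is harmless. -/
theorem sliceGamma_ofComplex {M : CayleyDickson v} (hM : M ∈ imaginary v) (h1 : ‖M‖ = 1) (w : ℂ) :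
    sliceGamma (ofComplex M w) = ofComplex M (Complex.Gamma w) := by
  rw [sliceGamma, toComplex_ofComplex hM h1, imaginaryPart_ofComplex hM, norm_smul, h1, mul_one,
    ofComplex_apply, smul_smul, Real.norm_eq_abs]
  rcases lt_trichotomy w.im 0 with h | h | h
  · have e : (⟨w.re, |w.im|⟩ : ℂ) = (starRingEnd ℂ) w := by
      apply Complex.ext <;> simp [abs_of_neg h]
    rw [e, Complex.Gamma_conj, abs_of_neg h]
    simp only [Complex.conj_re, Complex.conj_im]
    congr 2
    have := h.ne
    field_simp
  · have e : w = (w.re : ℂ) := by apply Complex.ext <;> simp [h]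
    have h3 : (Complex.Gamma w).im = 0 := by rw [e, Complex.Gamma_ofReal, Complex.ofReal_im]
    have e' : (⟨w.re, |w.im|⟩ : ℂ) = w := by apply Complex.ext <;> simp [h]
    rw [e', h3, h]; simp
  · have e : (⟨w.re, |w.im|⟩ : ℂ) = w := by apply Complex.ext <;> simp [abs_of_pos h]
    rw [e, abs_of_pos h, div_mul_cancel₀ _ h.ne']

theorem mem_gammaPoles_iff (M : CayleyDickson v) {z : CayleyDickson v} :
    z ∈ gammaPoles v ↔ ∃ n : ℕ, z = ofComplex M (-n) := by
  simp [gammaPoles, ofComplex_apply]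

/-- On `(0, 1)` the factor `e^{-t}` is at least `e^{-1}`, so `t^{re w - 1}` must be integrable
there. Thus Euler's integral converges only where it represents the complex Γ. -/
theorem re_pos_of_integrableOn {M : CayleyDickson v} (hM : M ∈ imaginary v) (h1 : ‖M‖ = 1) {w : ℂ}
    (h : MeasureTheory.IntegrableOn (gammaIntegrand (ofComplex M w)) (Set.Ioi 0)) : 0 < w.re := by
  have h2 : MeasureTheory.IntegrableOn (fun t : ℝ => t ^ (w.re - 1)) (Set.Ioo 0 1) := by
    refine MeasureTheory.Integrable.mono'
      ((h.mono_set Set.Ioo_subset_Ioi_self).norm.const_mul (Real.exp 1)) (by fun_prop) ?_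
    filter_upwards [MeasureTheory.ae_restrict_mem measurableSet_Ioo] with t ht
    rw [gammaIntegrand_ofComplex hM h1 w ht.1, norm_ofComplex hM h1, norm_mul,
      Complex.norm_cpow_eq_rpow_re_of_pos ht.1, Complex.norm_real,
      Real.norm_of_nonneg (Real.exp_pos _).le, ← mul_assoc, ← Real.exp_add,
      Real.norm_of_nonneg (Real.rpow_nonneg ht.1.le _)]
    have h3 : 1 ≤ Real.exp (1 + -t) := Real.one_le_exp (by linarith [ht.2])
    have h4 := Real.rpow_nonneg ht.1.le (w.re - 1)
    simp only [Complex.sub_re, Complex.one_re]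
    nlinarith
  have := (intervalIntegral.integrableOn_Ioo_rpow_iff one_pos).1 h2
  linarith

theorem integrableOn_gammaIntegrand_and_integral_eq {M : CayleyDickson v} (hM : M ∈ imaginary v)
    (h1 : ‖M‖ = 1) {w : ℂ} (hw : 0 < w.re) :
    MeasureTheory.IntegrableOn (gammaIntegrand (ofComplex M w)) (Set.Ioi 0) ∧
      ∫ t in Set.Ioi (0 : ℝ), gammaIntegrand (ofComplex M w) t = ofComplex M (Complex.Gamma w) := by
  have hc := Complex.GammaIntegral_convergent hw
  have heq : Set.EqOn (fun t : ℝ => ofComplex M (Real.exp (-t) * (t : ℂ) ^ (w - 1)))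
      (gammaIntegrand (ofComplex M w)) (Set.Ioi 0) := fun t ht =>
    (gammaIntegrand_ofComplex hM h1 w ht).symm
  constructor
  · refine MeasureTheory.IntegrableOn.congr_fun ?_ heq measurableSet_Ioi
    exact (ofComplex M).integrable_comp hc
  · rw [← MeasureTheory.setIntegral_congr_fun measurableSet_Ioi heq,
      (ofComplex M).integral_comp_comm hc, Complex.Gamma_eq_integral hw]
    rfl

/-- `toComplex` involves `|im|`, which is not analytic here. Real Taylor coefficients instead give
one series in `npow h n` valid on all slices at once. -/
theorem holomorphicAt_sliceGamma_of_real (hv : 1 ≤ v) {a : ℝ} (ha : ∀ m : ℕ, a ≠ -m) :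
    HolomorphicAt sliceGamma (a • (1 : CayleyDickson v)) := by
  obtain ⟨r, hr, p, hp⟩ := Complex.exists_real_hasSum_Gamma ha
  refine ⟨r, hr, fun n h => p n • npow h n, fun n => (IsHomogeneous.npow n).smul _, fun h hh => ?_⟩
  obtain ⟨M, hM, h1, w, rfl⟩ := exists_ofComplex hv h
  rw [norm_ofComplex hM h1] at hh
  have e : a • (1 : CayleyDickson v) + ofComplex M w = ofComplex M (a + w) := by
    rw [map_add]; congr 1; simp [ofComplex_apply]
  rw [e, sliceGamma_ofComplex hM h1]
  simpa only [npow_ofComplex hM h1, map_smul] using (hp w hh).mapL (ofComplex M)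

theorem analyticAt_sliceGamma {z : CayleyDickson v} (hz : imaginaryPart v z ≠ 0) :
    AnalyticAt ℝ sliceGamma z := by
  have hi := (imaginaryPart v).analyticAt z
  have hn : AnalyticAt ℝ (fun z => ‖imaginaryPart v z‖) z := (analyticAt_norm hz).comp hi
  have hr := (realPart v).toContinuousLinearMap.analyticAt z
  have hc : AnalyticAt ℝ (toComplex (v := v)) z := by
    have h := ((Complex.ofRealCLM.analyticAt _).comp hr).add
      (((Complex.ofRealCLM.analyticAt _).comp hn).mul (analyticAt_const (v := Complex.I)))
    refine h.congr (Eventually.of_forall fun z => ?_)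
    apply Complex.ext <;> simp [toComplex, imaginaryPart_apply]
  have hG : AnalyticAt ℝ (fun z => Complex.Gamma (toComplex z)) z := by
    refine AnalyticAt.comp (g := Complex.Gamma) ?_ hc
    refine (Complex.analyticAt_Gamma fun m h => hz ?_).restrictScalars
    have := congrArg Complex.im h
    simpa [toComplex, imaginaryPart_apply] using this
  exact (((Complex.reCLM.analyticAt _).comp hG).smul analyticAt_const).add
    ((((Complex.imCLM.analyticAt _).comp hG).div hn (norm_ne_zero_iff.2 hz)).smul hi)

theorem isGamma_sliceGamma (hv : 2 ≤ v) : IsGamma (sliceGamma (v := v)) where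
  eq_integral z hz := by
    obtain ⟨M, hM, h1, w, rfl⟩ := exists_ofComplex (by omega) z
    rw [sliceGamma_ofComplex hM h1, (integrableOn_gammaIntegrand_and_integral_eq hM h1
      (re_pos_of_integrableOn hM h1 hz)).2]
  holomorphic z hz := by
    by_cases h : imaginaryPart v z = 0
    · have e : z = realPart v z • (1 : CayleyDickson v) := sub_eq_zero.1 h
      rw [e]
      refine holomorphicAt_sliceGamma_of_real (by omega) fun m hm => hz ⟨m, ?_⟩
      rw [e, hm, neg_smul]
    · exact HolomorphicAt.of_analyticAt hv (analyticAt_sliceGamma h)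
  eq_zero z hz := by
    obtain ⟨M, hM, h1, -⟩ := exists_ofComplex (by omega) z
    obtain ⟨n, rfl⟩ := (mem_gammaPoles_iff M).1 hz
    rw [sliceGamma_ofComplex hM h1, Complex.Gamma_neg_nat_eq_zero, map_zero]

/-! ### Identification with the complex Gamma function on slices -/

theorem isGamma_Gamma (hv : 2 ≤ v) : IsGamma (Gamma (v := v)) := by
  have h : ∃ G : CayleyDickson v → CayleyDickson v, IsGamma G := ⟨_, isGamma_sliceGamma hv⟩
  rw [Gamma, dif_pos h]
  exact Classical.choose_spec h

theorem IsGamma.analyticOnNhd_line {G : CayleyDickson v → CayleyDickson v} (hG : IsGamma G)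
    {M : CayleyDickson v} (hM : M ∈ imaginary v) (h1 : ‖M‖ = 1) {y : ℝ} (hy : y ≠ 0) :
    AnalyticOnNhd ℝ (fun t : ℝ => G (ofComplex M (t + y * Complex.I))) Set.univ := by
  intro t _
  have hc : ofComplex M (t + y * Complex.I) ∉ gammaPoles v := fun h => by
    obtain ⟨n, hn⟩ := (mem_gammaPoles_iff M).1 h
    have := congrArg (fun z => ‖imaginaryPart v z‖) hn
    simp [imaginaryPart_ofComplex hM, h1, norm_smul, hy] at this
  have h := (hG.holomorphic _ hc).analyticAt_line 1
  have h2 : AnalyticAt ℝ (fun s : ℝ => s - t) t := by fun_prop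
  have h3 := AnalyticAt.comp_of_eq h h2 (sub_self t)
  refine h3.congr (Eventually.of_forall fun s => ?_)
  simp only [Function.comp]
  congr 1
  simp only [ofComplex_apply, Complex.add_re, Complex.add_im, Complex.ofReal_re, Complex.ofReal_im,
    Complex.re_ofReal_mul, Complex.im_ofReal_mul, Complex.I_re, Complex.I_im]
  module

/-- Identity theorem on the line `t + yM`, which misses the poles as `y ≠ 0`: both sides are Euler's
integral for `t > 0`. -/
theorem IsGamma.eq_ofComplex {G : CayleyDickson v → CayleyDickson v} (hG : IsGamma G)
    {M : CayleyDickson v} (hM : M ∈ imaginary v) (h1 : ‖M‖ = 1) (x : ℝ) {y : ℝ} (hy : y ≠ 0) :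
    G (ofComplex M (x + y * Complex.I)) = ofComplex M (Complex.Gamma (x + y * Complex.I)) := by
  have hΓ : AnalyticOnNhd ℝ (fun t : ℝ => ofComplex M (Complex.Gamma (t + y * Complex.I)))
      Set.univ := fun t _ => by
    refine ((ofComplex M).analyticAt _).comp
      (AnalyticAt.comp (g := Complex.Gamma) ?_ ?_)
    · refine (Complex.analyticAt_Gamma fun m h => hy ?_).restrictScalars
      simpa using congrArg Complex.im h
    · exact (Complex.ofRealCLM.analyticAt t).add analyticAt_const
  have heq := (hG.analyticOnNhd_line hM h1 hy).eq_of_eventuallyEq hΓ (z₀ := 1) (by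
    filter_upwards [lt_mem_nhds one_pos] with t ht
    have hre : 0 < (t + y * Complex.I : ℂ).re := by simpa using ht
    obtain ⟨hi, hint⟩ := integrableOn_gammaIntegrand_and_integral_eq hM h1 hre
    rw [hG.eq_integral _ hi, hint])
  exact congrFun heq x

theorem norm_Gamma_eq (hv : 2 ≤ v) {M : CayleyDickson v} (hM : M ∈ imaginary v) (h1 : ‖M‖ = 1)
    (x : ℝ) {y : ℝ} (hy : y ≠ 0) :
    ‖Gamma (x • (1 : CayleyDickson v) + y • M)‖ = ‖Complex.Gamma (x + y * Complex.I)‖ := by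
  have e : x • (1 : CayleyDickson v) + y • M = ofComplex M (x + y * Complex.I) := by
    simp [ofComplex_apply]
  rw [e, (isGamma_Gamma hv).eq_ofComplex hM h1 x hy, norm_ofComplex hM h1]

end CayleyDickson

theorem corollary10 (v : ℕ) (hv : 2 ≤ v) (x : ℝ) :
    ∀ ε : ℝ, 0 < ε → ∃ R : ℝ, 0 < R ∧
      ∀ M : CayleyDickson v, M ∈ CayleyDickson.imaginary v → ‖M‖ = 1 →
        ∀ y : ℝ, R ≤ |y| →
          |‖CayleyDickson.Gamma (x • (1 : CayleyDickson v) + y • M)‖ /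
              (Real.sqrt (2 * Real.pi) * |y| ^ (x - 1 / 2) * Real.exp (-Real.pi * |y| / 2)) - 1| < ε := by
  intro ε hε
  obtain ⟨R, hR⟩ := eventually_atTop.1 ((Metric.tendsto_nhds.1 (Complex.tendsto_norm_Gamma_div x)) ε hε)
  -- `R` comes from the complex limit, hence is independent of `M`; the 1 ensures `y ≠ 0`.
  refine ⟨max R 1, by positivity, fun M hM h1 y hy => ?_⟩
  have hy0 : y ≠ 0 := abs_pos.1 (one_pos.trans_le ((le_max_right _ _).trans hy))
  rw [CayleyDickson.norm_Gamma_eq hv hM h1 x hy0, ← Complex.norm_Gamma_add_mul_abs_I]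
  exact hR |y| ((le_max_left _ _).trans hy)
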